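/- A hypergraph $G=(V,E)$ has $n$ vertices and a finite multiset $E$ of $m$ non-empty edges $e\subseteq V$ such that every vertex lies in some edge. Its edges are presented one by one, in an arbitrary order, and the identifier of an edge is the time $t\in\{0,\dots,m-1\}$ of its arrival. Let $\mathrm{OPT}$ be a minimum-cardinality set of edges covering all vertices. For $0<\delta\le 1$, a $\delta$-cover certificate for $G$ is a partial function $\chi$ from $V$ to the identifiers such that $v\in e$ whenever $\chi(v)$ is the identifier of $e$, and such that $|\mathrm{Dom}(\chi)|\ge\delta n$; its image $\mathrm{Im}(\chi)$ is the set of identifiers it takes as values. A randomized one-pass streaming algorithm with $s$ bits of memory is a random choice of a deterministic one; a deterministic one updates an $s$-bit memory image upon each arriving edge, as a function of the edge, its identifier and the current memory image, and after the last edge outputs a partial function from $V$ to identifiers that depends only on the number $m$ of edges and the final memory image. Call it an $(n,s,\epsilon,\rho)$-algorithm if on every $n$-vertex hypergraph with at most $n^2$ edges it outputs, with probability $1$, a $(1-\epsilon)$-cover certificate $\chi$, and $\mathbb{E}\,|\mathrm{Im}(\chi)|\le\rho\cdot|\mathrm{OPT}|$. Theorem. There are a constant $\kappa>0$ and, for every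 $a>0$, a constant $C_a>0$ depending only on $a$, such that for every integer $n_0$ there exists an integer $n\ge n_0$ with the following property: for every $a>0$, every $\epsilon$ with $a/\sqrt{n}\le\epsilon<1$, every $s\le\kappa n^{3/2}$ and every real $\rho$, the existence of an $(n,s,\epsilon,\rho)$-algorithm implies $\rho\ge C_a/\epsilon$. In asymptotic notation: for infinitely many $n$ and every $\epsilon=\Omega(1/\sqrt n)$, $\epsilon<1$, the existence of an $(n,o(n^{3/2}),\epsilon,\rho)$-algorithm implies $\rho=\Omega(1/\epsilon)$. -/

import Mathlib

namespace EdgeCover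

/-- An unweighted hypergraph on the vertex set `Fin n`, together with the order in which its edges
are presented. The edges form a multiset (`edge` need not be injective), each edge is non-empty and
no vertex is isolated. The identifier of an edge is the time `t = 0, …, m - 1` of its arrival. -/
structure Hypergraph (n : ℕ) where
  m : ℕ
  edge : Fin m → Finset (Fin n)
  edge_nonempty : ∀ t, (edge t).Nonempty
  no_isolated : ∀ v, ∃ t, v ∈ edge t

/-- A set `F` of edges covers `G` if every vertex is incident to some edge in `F`. -/
def Hypergraph.Covers {n : ℕ} (G : Hypergraph n) (F : Finset (Fin G.m)) : Prop :=
  ∀ v, ∃ t ∈ F, v ∈ G.edge t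

/-- The cardinality of an optimal edge cover. The set of all edges is a cover, so this is the
minimum of a non-empty set of natural numbers. -/
noncomputable def Hypergraph.opt {n : ℕ} (G : Hypergraph n) : ℕ :=
  sInf {k | ∃ F : Finset (Fin G.m), G.Covers F ∧ F.card = k}

/-- The domain of a partial function from the vertices to edge identifiers. -/
def dom {n : ℕ} (χ : Fin n → Option ℕ) : Finset (Fin n) :=
  Finset.univ.filter fun v => (χ v).isSome

/-- The image of a partial function from the vertices to edge identifiers. -/
def im {n : ℕ} (χ : Fin n → Option ℕ) : Finset ℕ :=
  Finset.univ.biUnion fun v => (χ v).toFinset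

/-- `χ` is a `δ`-cover certificate for `G`: a vertex is only mapped to (identifiers of) edges of
`G` that contain it, and at least `δ n` vertices lie in the domain. -/
def IsCertificate {n : ℕ} (G : Hypergraph n) (δ : ℝ) (χ : Fin n → Option ℕ) : Prop :=
  (∀ v t, χ v = some t → ∃ h : t < G.m, v ∈ G.edge ⟨t, h⟩) ∧
    δ * (n : ℝ) ≤ ((dom χ).card : ℝ)

/-- A deterministic one-pass streaming algorithm on `n` vertices with `s` bits of memory. When the
edge with identifier `t` arrives, the new memory image is a function of `t`, of the edge and of the
old memory image. After the last edge, the output is a function of the number of edges presented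
and of the memory image. The computation within a single step is unrestricted. -/
structure DetAlgorithm (n s : ℕ) where
  init : Fin s → Bool
  step : ℕ → Finset (Fin n) → (Fin s → Bool) → (Fin s → Bool)
  output : ℕ → (Fin s → Bool) → (Fin n → Option ℕ)

/-- The memory image after the edges `edge 0, …, edge (m - 1)` have been presented. -/
def DetAlgorithm.memory {n s : ℕ} (A : DetAlgorithm n s) {m : ℕ}
    (edge : Fin m → Finset (Fin n)) : Fin s → Bool :=
  Fin.foldl m (fun M t => A.step t (edge t) M) A.init

/-- The output of the algorithm on the stream of edges of `G`. -/
def DetAlgorithm.run {n s : ℕ} (A : DetAlgorithm n s) (G : Hypergraph n) : Fin n → Option ℕ :=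
  A.output G.m (A.memory G.edge)

/-- A randomized one-pass streaming algorithm on `n` vertices with `s` bits of memory: a random
choice of a deterministic one, on an arbitrary probability space. (The random bits are not charged
to the memory, so algorithms that toss fresh coins at every step are included.) The output on every
input is a random variable. -/
structure RandAlgorithm (n s : ℕ) where
  Ω : Type*
  [measurableSpace : MeasurableSpace Ω]
  P : MeasureTheory.Measure Ω
  [isProbabilityMeasure : MeasureTheory.IsProbabilityMeasure P]
  alg : Ω → DetAlgorithm n s
  measurableSet_run : ∀ (G : Hypergraph n) (χ : Fin n → Option ℕ),
    MeasurableSet {ω | (alg ω).run G = χ}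

attribute [instance] RandAlgorithm.measurableSpace RandAlgorithm.isProbabilityMeasure

/-- On every `n`-vertex hypergraph with at most `M` edges, the algorithm outputs with probability
`1` a `(1 - ε)`-cover certificate, and the expected cardinality of its image is at most `ρ` times
the cardinality of an optimal edge cover. (The image has at most `n` elements, hence the
expectation is always that of a bounded random variable.) -/
def RandAlgorithm.Guarantees {n s : ℕ} (A : RandAlgorithm n s) (M : ℕ) (ε ρ : ℝ) : Prop :=
  ∀ G : Hypergraph n, G.m ≤ M →
    (∀ᵐ ω ∂A.P, IsCertificate G (1 - ε) ((A.alg ω).run G)) ∧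
      ∫ ω, ((im ((A.alg ω).run G)).card : ℝ) ∂A.P ≤ ρ * (G.opt : ℝ)

end EdgeCover


/-!
Embed the plane over a field with `q` elements into the vertex set, where `q ^ 2 < n ≤ 4 * q ^ 2`.
Random bits split every line into two halves. The stream presents all the halves, and finally the
complement of a strip of `k` parallel lines. The `2 * k` halves that make up the strip cover it, so
the optimum is at most `2 * k + 1`. A line of any other slope meets the strip in at most `k` points,
so a certificate with few edges has to map most points of the strip to halves of the lines of the
strip, and each of these values reveals a random bit. The memory image before the last edge
determines the outputs for all strips, hence all the bits they reveal, and `s` bits of memory can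
with probability at least `1 / 2` reveal at most `s` of the `q ^ 3` random bits. Averaging over all
strips, the output then has about `q` edges, and `k` is chosen to be of the order of `ε * q`.
-/

namespace EdgeCover

open Finset MeasureTheory

section Counting

variable {ι β : Type*} [Fintype β]

lemma card_filter_forall_mem_eq_mul_pow_le [DecidableEq β] (t : Finset β) :
    #{b | ∀ b' ∈ t, b = b'} * Fintype.card β ^ #t ≤ Fintype.card β := by
  obtain rfl | ht := t.eq_empty_or_nonempty
  · simp
  obtain ⟨b, rfl⟩ | ⟨b, hb, b', hb', hne⟩ := ht.exists_eq_singleton_or_nontrivial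
  · simp [filter_eq']
  · rw [filter_false_of_mem fun x _ hx => hne ((hx b hb).symm.trans (hx b' hb'))]
    simp

variable [Fintype ι] [DecidableEq ι]

lemma card_consistent_mul_pow_le [DecidableEq β] (K : Finset (ι × β)) :
    #{X : ι → β | ∀ p ∈ K, X p.1 = p.2} * Fintype.card β ^ #K ≤
      Fintype.card β ^ Fintype.card ι := by
  have hconsistent : ({X | ∀ p ∈ K, X p.1 = p.2} : Finset (ι → β)) =
      Fintype.piFinset fun i => {b | ∀ b' ∈ ({b' | (i, b') ∈ K} : Finset β), b = b'} := by
    ext X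
    simp
  have hK : #K = ∑ i, #{b | (i, b) ∈ K} := by
    simp only [card_filter, ← Fintype.sum_prod_type (fun p => if p ∈ K then 1 else 0)]
    simp
  rw [hconsistent, Fintype.card_piFinset, hK, ← prod_pow_eq_pow_sum, ← prod_mul_distrib,
    ← Finset.card_univ (α := ι), ← prod_const]
  exact prod_le_prod' fun i _ => card_filter_forall_mem_eq_mul_pow_le _

/-- Group the functions by their message `f X`: the functions in a group are all consistent with
the same set of values. -/
lemma card_filter_lt_card_mul_pow_le {T : Type*} [Fintype T] (f : (ι → β) → T)
    (K : T → Finset (ι × β)) (hK : ∀ X, ∀ p ∈ K (f X), X p.1 = p.2) (s : ℕ) :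
    #{X | s < #(K (f X))} * Fintype.card β ^ (s + 1) ≤
      Fintype.card T * Fintype.card β ^ Fintype.card ι := by
  classical
  rw [card_eq_sum_card_fiberwise (f := f) (t := univ) (by simp [Set.MapsTo]), sum_mul,
    ← smul_eq_mul (Fintype.card T), ← Finset.card_univ (α := T), ← sum_const]
  refine sum_le_sum fun M _ => ?_
  obtain hM | hM := le_or_gt #(K M) s
  · rw [filter_filter, filter_false_of_mem (by rintro X - ⟨hX, rfl⟩; exact hX.not_ge hM)]
    simp
  · obtain ⟨⟨-, b⟩, -⟩ := card_pos.1 (s.zero_le.trans_lt hM)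
    have : Nonempty β := ⟨b⟩
    refine le_trans (Nat.mul_le_mul (card_le_card fun X hX => ?_)
      (Nat.pow_le_pow_right Fintype.card_pos hM)) (card_consistent_mul_pow_le (K M))
    obtain ⟨-, rfl⟩ := mem_filter.1 hX
    exact mem_filter.2 ⟨mem_univ X, hK X⟩

lemma two_pow_card_le_two_mul_card_filter {s : ℕ} (f : (ι → Bool) → Fin s → Bool)
    (K : (Fin s → Bool) → Finset (ι × Bool)) (hK : ∀ X, ∀ p ∈ K (f X), X p.1 = p.2) :
    2 ^ Fintype.card ι ≤ 2 * #{X | #(K (f X)) ≤ s} := by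
  have hmany : 2 * #{X | s < #(K (f X))} ≤ 2 ^ Fintype.card ι := by
    have := card_filter_lt_card_mul_pow_le f K hK s
    simp only [Fintype.card_bool, Fintype.card_fun, Fintype.card_fin, pow_succ] at this
    exact Nat.le_of_mul_le_mul_left (by linarith) (Nat.two_pow_pos s)
  have hsplit := card_filter_add_card_filter_not (s := (univ : Finset (ι → Bool)))
    (fun X => #(K (f X)) ≤ s)
  simp only [not_le, Finset.card_univ, Fintype.card_fun, Fintype.card_bool] at hsplit
  omega

end Counting

section Certificates

variable {n : ℕ}

lemma mem_dom {χ : Fin n → Option ℕ} {v : Fin n} : v ∈ dom χ ↔ ∃ t, χ v = some t := by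
  simp [dom, Option.isSome_iff_exists]

lemma mem_im {χ : Fin n → Option ℕ} {t : ℕ} : t ∈ im χ ↔ ∃ v, χ v = some t := by
  simp [im]

lemma card_im_le (χ : Fin n → Option ℕ) : #(im χ) ≤ n := by
  refine card_biUnion_le.trans ((sum_le_card_nsmul _ _ 1 fun v _ => ?_).trans (by simp))
  cases χ v <;> simp

lemma Hypergraph.Covers.opt_le {G : Hypergraph n} {T : Finset (Fin G.m)} (hT : G.Covers T) :
    G.opt ≤ #T :=
  Nat.sInf_le ⟨T, hT, rfl⟩

variable {G : Hypergraph n} {χ : Fin n → Option ℕ} {δ ε : ℝ}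

lemma IsCertificate.mono {δ' : ℝ} (h : δ' ≤ δ) (hχ : IsCertificate G δ χ) :
    IsCertificate G δ' χ :=
  ⟨hχ.1, (mul_le_mul_of_nonneg_right h n.cast_nonneg).trans hχ.2⟩

lemma IsCertificate.mem_edge (hχ : IsCertificate G δ χ) {v : Fin n} {t : Fin G.m}
    (h : χ v = some (t : ℕ)) : v ∈ G.edge t :=
  (hχ.1 v t h).2

lemma IsCertificate.card_compl_dom_le (hχ : IsCertificate G (1 - ε) χ) :
    (#(dom χ)ᶜ : ℝ) ≤ ε * n := by
  have hcompl : (#(dom χ)ᶜ : ℝ) + #(dom χ) = n := by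
    exact_mod_cast (card_compl_add_card (dom χ)).trans (Fintype.card_fin n)
  linarith [hχ.2]

lemma IsCertificate.one_le_card_im (hn : 0 < n) (hδ : 0 < δ) (hχ : IsCertificate G δ χ) :
    1 ≤ #(im χ) := by
  have hdom : (0 : ℝ) < #(dom χ) := (mul_pos hδ (Nat.cast_pos.2 hn)).trans_le hχ.2
  obtain ⟨v, hv⟩ := card_pos.1 (Nat.cast_pos.1 hdom)
  obtain ⟨t, ht⟩ := mem_dom.1 hv
  exact card_pos.2 ⟨t, mem_im.2 ⟨v, ht⟩⟩

end Certificates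

section Algorithms

variable {n s M : ℕ} {ε ρ : ℝ} {A : RandAlgorithm n s}

lemma DetAlgorithm.memory_snoc (D : DetAlgorithm n s) {m : ℕ} (edge : Fin m → Finset (Fin n))
    (E : Finset (Fin n)) :
    D.memory (Fin.snoc (α := fun _ => Finset (Fin n)) edge E) = D.step m E (D.memory edge) := by
  simp [DetAlgorithm.memory, Fin.foldl_succ_last]

lemma RandAlgorithm.integrable_card_im (A : RandAlgorithm n s) (G : Hypergraph n) :
    Integrable (fun ω => (#(im ((A.alg ω).run G)) : ℝ)) A.P := by
  let _ : MeasurableSpace (Fin n → Option ℕ) := ⊤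
  have hrun : Measurable fun ω => (A.alg ω).run G :=
    measurable_to_countable' fun χ => A.measurableSet_run G χ
  have hcard : Measurable fun ω => (#(im ((A.alg ω).run G)) : ℝ) :=
    (measurable_from_top (f := fun χ : Fin n → Option ℕ => (#(im χ) : ℝ))).comp hrun
  refine Integrable.of_bound hcard.aestronglyMeasurable (n : ℝ) (ae_of_all _ fun ω => ?_)
  simpa using card_im_le _

lemma RandAlgorithm.Guarantees.mono {ε' : ℝ} (h : ε ≤ ε') (hA : A.Guarantees M ε ρ) :
    A.Guarantees M ε' ρ := fun G hG =>
  ⟨(hA G hG).1.mono fun _ => IsCertificate.mono (sub_le_sub_left h 1), (hA G hG).2⟩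

/-- The easy direction of Yao's principle. -/
lemma RandAlgorithm.Guarantees.le_mul_sum_opt {ι : Type*} [Fintype ι] {G : ι → Hypergraph n}
    {w : ι → ℝ} {B : ℝ} (hA : A.Guarantees M ε ρ) (hG : ∀ i, (G i).m ≤ M) (hw : ∀ i, 0 ≤ w i)
    (hB : ∀ D : DetAlgorithm n s, (∀ i, IsCertificate (G i) (1 - ε) (D.run (G i))) →
      B ≤ ∑ i, w i * #(im (D.run (G i)))) :
    B ≤ ρ * ∑ i, w i * (G i).opt := by
  have hint : ∀ i, Integrable (fun ω => w i * #(im ((A.alg ω).run (G i)))) A.P :=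
    fun i => (A.integrable_card_im (G i)).const_mul (w i)
  have hcert : ∀ᵐ ω ∂A.P, ∀ i, IsCertificate (G i) (1 - ε) ((A.alg ω).run (G i)) :=
    ae_all_iff.2 fun i => (hA (G i) (hG i)).1
  calc B = ∫ _, B ∂A.P := by simp
    _ ≤ ∫ ω, ∑ i, w i * #(im ((A.alg ω).run (G i))) ∂A.P :=
      integral_mono_ae (integrable_const B) (integrable_finsetSum _ fun i _ => hint i)
        (hcert.mono fun ω => hB (A.alg ω))
    _ = ∑ i, w i * ∫ ω, (#(im ((A.alg ω).run (G i))) : ℝ) ∂A.P := by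
      rw [integral_finsetSum _ fun i _ => hint i]
      simp only [integral_const_mul]
    _ ≤ ∑ i, w i * (ρ * (G i).opt) := by
      gcongr with i
      · exact hw i
      · exact (hA (G i) (hG i)).2
    _ = ρ * ∑ i, w i * (G i).opt := by
      rw [mul_sum]
      exact sum_congr rfl fun i _ => mul_left_comm _ _ _

lemma RandAlgorithm.Guarantees.one_le (hn : 0 < n) (hM : 1 ≤ M) (hε : ε < 1)
    (hA : A.Guarantees M ε ρ) : 1 ≤ ρ := by
  let G : Hypergraph n :=
    { m := 1
      edge := fun _ => univ
      edge_nonempty := fun _ => ⟨⟨0, hn⟩, mem_univ _⟩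
      no_isolated := fun v => ⟨0, mem_univ v⟩ }
  have hcover : G.Covers {0} := fun v => ⟨0, mem_singleton_self _, mem_univ v⟩
  have hopt : G.opt ≤ 1 := hcover.opt_le
  have hρ : 1 ≤ ρ * G.opt := by
    simpa using hA.le_mul_sum_opt (G := fun _ : Unit => G) (w := fun _ => 1) (B := 1)
      (fun _ => hM) (fun _ => zero_le_one)
      (fun D hD => by simpa using (hD ()).one_le_card_im hn (sub_pos.2 hε))
  obtain hopt_zero | hopt_one := Nat.le_one_iff_eq_zero_or_eq_one.1 hopt
  · norm_num [hopt_zero] at hρ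
  · simpa [hopt_one] using hρ

end Algorithms

section Plane

variable {F : Type*} [Ring F]

/-- The intercept of the line of slope `α` through the point `p`. -/
def intercept (α : F) (p : F × F) : F :=
  p.2 - α * p.1

lemma intercept_eq_intercept_iff {α : F} {p p' : F × F} :
    intercept α p = intercept α p' ↔ α * (p.1 - p'.1) = p.2 - p'.2 := by
  rw [intercept, intercept, sub_eq_sub_iff_sub_eq_sub, mul_sub, eq_comm]

lemma eq_of_intercept_eq [NoZeroDivisors F] {α α' : F} (hα : α ≠ α') {p p' : F × F}
    (h : intercept α p = intercept α p') (h' : intercept α' p = intercept α' p') : p = p' := by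
  rw [intercept_eq_intercept_iff] at h h'
  have hprod : (α - α') * (p.1 - p'.1) = 0 := by rw [sub_mul, h, h', sub_self]
  have hfst : p.1 - p'.1 = 0 := (mul_eq_zero.1 hprod).resolve_left (sub_ne_zero.2 hα)
  rw [hfst, mul_zero] at h
  exact Prod.ext (sub_eq_zero.1 hfst) (sub_eq_zero.1 h.symm)

variable [Fintype F] [DecidableEq F]

/-- The union of the lines with slope `c.1` whose intercepts lie in `c.2 + S`. -/
def strip (S : Finset F) (c : F × F) : Finset (F × F) :=
  {p | intercept c.1 p - c.2 ∈ S}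

/-- Half of the line with slope `l.1` and intercept `l.2`: for every slope `α`, the bits `X (α, p)`
split each line of slope `α` into two halves. -/
def halfLine (X : F × F × F → Bool) (l : F × F) (b : Bool) : Finset (F × F) :=
  {p | intercept l.1 p = l.2 ∧ X (l.1, p) = b}

@[simp]
lemma mem_strip {S : Finset F} {c p : F × F} : p ∈ strip S c ↔ intercept c.1 p - c.2 ∈ S := by
  simp [strip]

@[simp]
lemma mem_halfLine {X : F × F × F → Bool} {l p : F × F} {b : Bool} :
    p ∈ halfLine X l b ↔ intercept l.1 p = l.2 ∧ X (l.1, p) = b := by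
  simp [halfLine]

lemma card_strip (S : Finset F) (c : F × F) : #(strip S c) = Fintype.card F * #S := by
  rw [← Finset.card_univ, ← card_product]
  refine card_bij' (fun p _ => (p.1, intercept c.1 p - c.2))
    (fun p _ => (p.1, p.2 + c.2 + c.1 * p.1)) ?_ ?_ ?_ ?_ <;> simp [intercept]

lemma card_strip_inter_line_le [NoZeroDivisors F] (S : Finset F) {c l : F × F} (h : l.1 ≠ c.1) :
    #{p ∈ strip S c | intercept l.1 p = l.2} ≤ #S := by
  refine card_le_card_of_injOn (fun p => intercept c.1 p - c.2) (fun p hp => ?_)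
    fun p hp p' hp' hpp' => ?_
  · exact mem_strip.1 (mem_filter.1 hp).1
  · exact eq_of_intercept_eq h ((mem_filter.1 hp).2.trans (mem_filter.1 hp').2.symm)
      (sub_left_injective hpp')

end Plane

section HardInstance

variable {F : Type*} [Fintype F]

/-- The identifier of a half of the line `l` in the hard stream, whose last edge is not of this
form. -/
noncomputable def halfLineId (l : F × F) (b : Bool) : Fin (Fintype.card ((F × F) × Bool) + 1) :=
  (Fintype.equivFin _ (l, b)).castSucc

lemma eq_last_or_exists_eq_halfLineId (t : Fin (Fintype.card ((F × F) × Bool) + 1)) :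
    t = Fin.last _ ∨ ∃ (l : F × F) (b : Bool), t = halfLineId l b := by
  induction t using Fin.lastCases with
  | last => exact .inl rfl
  | cast j =>
    refine .inr ⟨((Fintype.equivFin _).symm j).1, ((Fintype.equivFin _).symm j).2, ?_⟩
    simp [halfLineId]

variable [DecidableEq F] {n : ℕ}

/-- The image of `P` together with all vertices outside the embedded plane. These padding vertices
lie in every edge of the hard instance, which makes all its edges non-empty. -/
def padded (e : F × F ↪ Fin n) (P : Finset (F × F)) : Finset (Fin n) :=
  (Pᶜ.map e)ᶜ

@[simp]
lemma apply_mem_padded {e : F × F ↪ Fin n} {P : Finset (F × F)} {p : F × F} :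
    e p ∈ padded e P ↔ p ∈ P := by
  simp [padded]

lemma mem_padded_of_notMem_range {e : F × F ↪ Fin n} (P : Finset (F × F)) {v : Fin n}
    (hv : v ∉ Set.range e) : v ∈ padded e P := by
  simp only [padded, mem_compl, mem_map, not_exists, not_and]
  exact fun p _ hp => hv ⟨p, hp⟩

variable [Ring F] (e : F × F ↪ Fin n) (S : Finset F) (X : F × F × F → Bool) (c : F × F)

/-- The stream that presents both halves of every line; it does not depend on the strip. -/
noncomputable def halfLineStream : Fin (Fintype.card ((F × F) × Bool)) → Finset (Fin n) :=
  fun j => let i := (Fintype.equivFin _).symm j; padded e (halfLine X i.1 i.2)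

/-- The hard stream: both halves of every line, and finally the complement of a strip. -/
noncomputable def hardStream : Fin (Fintype.card ((F × F) × Bool) + 1) → Finset (Fin n) :=
  Fin.snoc (α := fun _ => Finset (Fin n)) (halfLineStream e X) (padded e (strip S c)ᶜ)

@[simp]
lemma hardStream_last : hardStream e S X c (Fin.last _) = padded e (strip S c)ᶜ :=
  Fin.snoc_last _ _

@[simp]
lemma hardStream_halfLineId (l : F × F) (b : Bool) :
    hardStream e S X c (halfLineId l b) = padded e (halfLine X l b) := by
  simp [hardStream, halfLineId, halfLineStream]

lemma apply_mem_hardStream_halfLineId (α : F) (p : F × F) :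
    e p ∈ hardStream e S X c (halfLineId (α, intercept α p) (X (α, p))) := by
  simp

variable (he : ∃ v, v ∉ Set.range e)

/-- The hypergraph presented by `hardStream`. -/
noncomputable def hardInstance : Hypergraph n where
  m := Fintype.card ((F × F) × Bool) + 1
  edge := hardStream e S X c
  edge_nonempty t := by
    obtain ⟨v, hv⟩ := he
    obtain rfl | ⟨l, b, rfl⟩ := eq_last_or_exists_eq_halfLineId t
    · exact ⟨v, by simpa only [hardStream_last] using mem_padded_of_notMem_range _ hv⟩
    · exact ⟨v, by simpa only [hardStream_halfLineId] using mem_padded_of_notMem_range _ hv⟩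
  no_isolated v := by
    by_cases hv : v ∈ Set.range e
    · obtain ⟨p, rfl⟩ := hv
      exact ⟨_, apply_mem_hardStream_halfLineId e S X c 0 p⟩
    · exact ⟨Fin.last _, by simpa only [hardStream_last] using mem_padded_of_notMem_range _ hv⟩

lemma opt_hardInstance_le : (hardInstance e S X c he).opt ≤ 2 * #S + 1 := by
  let T : Finset (Fin (Fintype.card ((F × F) × Bool) + 1)) :=
    insert (Fin.last _) ((S ×ˢ univ).image fun i => halfLineId (c.1, i.1 + c.2) i.2)
  have hcover : (hardInstance e S X c he).Covers T := fun v => by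
    by_cases hv : v ∈ padded e (strip S c)ᶜ
    · exact ⟨Fin.last _, mem_insert_self _ _, by simpa [hardInstance] using hv⟩
    obtain ⟨p, rfl⟩ : v ∈ Set.range e := by
      by_contra hrange
      exact hv (mem_padded_of_notMem_range _ hrange)
    refine ⟨_, mem_insert_of_mem (mem_image.2 ⟨(intercept c.1 p - c.2, X (c.1, p)), ?_, ?_⟩),
      apply_mem_hardStream_halfLineId e S X c c.1 p⟩
    · simpa using hv
    · rw [sub_add_cancel]
  calc (hardInstance e S X c he).opt ≤ #T := hcover.opt_le
    _ ≤ #((S ×ˢ univ).image fun i : F × Bool => halfLineId (c.1, i.1 + c.2) i.2) + 1 :=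
      card_insert_le _ _
    _ ≤ #(S ×ˢ (univ : Finset Bool)) + 1 := Nat.add_le_add_right card_image_le 1
    _ = 2 * #S + 1 := by simp [card_product, mul_comm]

/-- The points of the strip that `χ` maps to a half of the line of the strip through them. Each of
them reveals a bit of `X`. -/
noncomputable def revealed (χ : Fin n → Option ℕ) : Finset (F × F) :=
  {p ∈ strip S c | ∃ b, χ (e p) = some (halfLineId (c.1, intercept c.1 p) b : ℕ)}

/-- The points of the strip that `χ` maps to a half of a line that is not parallel to the strip. -/
noncomputable def crossing (χ : Fin n → Option ℕ) : Finset (F × F) :=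
  {p ∈ strip S c | ∃ l b, l.1 ≠ c.1 ∧ χ (e p) = some (halfLineId l b : ℕ)}

variable {e S X c he} {δ ε : ℝ} {χ : Fin n → Option ℕ}

lemma IsCertificate.mem_halfLine_of_eq_some
    (hχ : IsCertificate (hardInstance e S X c he) δ χ) {p l : F × F} {b : Bool}
    (h : χ (e p) = some (halfLineId l b : ℕ)) : p ∈ halfLine X l b := by
  have hedge : e p ∈ hardStream e S X c (halfLineId l b) := hχ.mem_edge h
  rwa [hardStream_halfLineId, apply_mem_padded] at hedge

lemma IsCertificate.exists_halfLineId (hχ : IsCertificate (hardInstance e S X c he) δ χ)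
    {p : F × F} (hp : p ∈ strip S c) {t : ℕ} (h : χ (e p) = some t) :
    ∃ (l : F × F) (b : Bool), t = (halfLineId l b : ℕ) := by
  obtain ⟨ht, hedge⟩ := hχ.1 _ _ h
  obtain hlast | ⟨l, b, hlb⟩ := eq_last_or_exists_eq_halfLineId ⟨t, ht⟩
  · have hedge' : e p ∈ hardStream e S X c ⟨t, ht⟩ := hedge
    rw [hlast, hardStream_last, apply_mem_padded] at hedge'
    exact absurd hp (mem_compl.1 hedge')
  · exact ⟨l, b, congrArg Fin.val hlb⟩

lemma IsCertificate.strip_subset (hχ : IsCertificate (hardInstance e S X c he) δ χ) :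
    strip S c ⊆ ({p | e p ∉ dom χ} : Finset (F × F)) ∪ (revealed e S c χ ∪ crossing e S c χ) := by
  intro p hp
  by_cases hdom : e p ∈ dom χ
  swap
  · exact mem_union_left _ (mem_filter.2 ⟨mem_univ p, hdom⟩)
  refine mem_union_right _ (mem_union.2 ?_)
  obtain ⟨t, ht⟩ := mem_dom.1 hdom
  obtain ⟨⟨α, β⟩, b, rfl⟩ := hχ.exists_halfLineId hp ht
  by_cases hα : α = c.1
  · obtain rfl : intercept α p = β := (mem_halfLine.1 (hχ.mem_halfLine_of_eq_some ht)).1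
    exact .inl (mem_filter.2 ⟨hp, b, hα ▸ ht⟩)
  · exact .inr (mem_filter.2 ⟨hp, (α, β), b, hα, ht⟩)

lemma IsCertificate.card_crossing_le [NoZeroDivisors F]
    (hχ : IsCertificate (hardInstance e S X c he) δ χ) :
    #(crossing e S c χ) ≤ #S * #(im χ) := by
  have hmaps : ∀ p ∈ crossing e S c χ, (χ (e p)).getD 0 ∈ im χ := fun p hp => by
    obtain ⟨-, l, b, -, h⟩ := mem_filter.1 hp
    exact mem_im.2 ⟨e p, by simp [h]⟩
  refine card_le_mul_card_image_of_maps_to hmaps _ fun t _ => ?_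
  obtain hempty | ⟨p₀, hp₀⟩ := ({p ∈ crossing e S c χ | (χ (e p)).getD 0 = t} :
    Finset (F × F)).eq_empty_or_nonempty
  · simp [hempty]
  obtain ⟨hcrossing, rfl⟩ := mem_filter.1 hp₀
  obtain ⟨-, l, b, hl, hlb⟩ := mem_filter.1 hcrossing
  refine (card_le_card fun p hp => ?_).trans (card_strip_inter_line_le S hl)
  obtain ⟨hp, hpp₀⟩ := mem_filter.1 hp
  obtain ⟨hstrip, l', b', -, hlb'⟩ := mem_filter.1 hp
  have hp_lb : χ (e p) = some (halfLineId l b : ℕ) := by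
    simp only [hlb, hlb', Option.getD_some] at hpp₀
    rw [hlb', hpp₀]
  exact mem_filter.2 ⟨hstrip, (mem_halfLine.1 (hχ.mem_halfLine_of_eq_some hp_lb)).1⟩

lemma IsCertificate.card_mul_card_le [NoZeroDivisors F]
    (hχ : IsCertificate (hardInstance e S X c he) (1 - ε) χ) :
    (Fintype.card F * #S : ℝ) ≤ ε * n + #(revealed e S c χ) + #S * #(im χ) := by
  have hundefined : #{p | e p ∉ dom χ} ≤ #(dom χ)ᶜ :=
    card_le_card_of_injOn e (fun p hp => by simpa using hp) e.injective.injOn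
  have hstrip : Fintype.card F * #S ≤
      #(dom χ)ᶜ + (#(revealed e S c χ) + #S * #(im χ)) := by
    rw [← card_strip S c]
    refine (card_le_card hχ.strip_subset).trans ((card_union_le _ _).trans ?_)
    exact Nat.add_le_add hundefined
      ((card_union_le _ _).trans (Nat.add_le_add_left hχ.card_crossing_le _))
  have hdom := hχ.card_compl_dom_le
  rify at hstrip
  linarith

end HardInstance

section LowerBound

variable {F : Type*} [Fintype F] [DecidableEq F] [Ring F] {n s : ℕ}

/-- The output on `hardInstance` as a function of the memory image before the last edge. -/
noncomputable def DetAlgorithm.outputAfter (D : DetAlgorithm n s) (e : F × F ↪ Fin n) (S : Finset F)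
    (c : F × F) (M : Fin s → Bool) : Fin n → Option ℕ :=
  D.output (Fintype.card ((F × F) × Bool) + 1)
    (D.step (Fintype.card ((F × F) × Bool)) (padded e (strip S c)ᶜ) M)

/-- The bits that the outputs for the various strips certify, given the memory image before the
last edge. -/
noncomputable def DetAlgorithm.knownBits (D : DetAlgorithm n s) (e : F × F ↪ Fin n) (S : Finset F)
    (M : Fin s → Bool) : Finset ((F × F × F) × Bool) :=
  {i | ∃ β, D.outputAfter e S (i.1.1, β) M (e i.1.2) =
    some (halfLineId (i.1.1, intercept i.1.1 i.1.2) i.2 : ℕ)}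

variable (D : DetAlgorithm n s) (e : F × F ↪ Fin n) (S : Finset F)

lemma DetAlgorithm.run_hardInstance (X : F × F × F → Bool) (c : F × F)
    (he : ∃ v, v ∉ Set.range e) :
    D.run (hardInstance e S X c he) = D.outputAfter e S c (D.memory (halfLineStream e X)) :=
  congrArg (D.output _) (D.memory_snoc _ _)

/-- A point lies in `#S` strips of each slope, so every known bit is counted at most `#S` times. -/
lemma DetAlgorithm.sum_card_revealed_le (M : Fin s → Bool) :
    ∑ c, #(revealed e S c (D.outputAfter e S c M)) ≤ #S * #(D.knownBits e S M) := by
  refine le_trans ?_ (Nat.mul_le_mul_left _ (card_image_le (f := Prod.fst)))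
  rw [← card_sigma, ← card_product]
  refine card_le_card_of_injOn (fun i => (intercept i.1.1 i.2 - i.1.2, (i.1.1, i.2))) ?_ ?_
  · rintro ⟨⟨α, β⟩, p⟩ hp
    obtain ⟨hstrip, b, hb⟩ := mem_filter.1 (mem_sigma.1 hp).2
    exact mem_product.2 ⟨mem_strip.1 hstrip, mem_image.2
      ⟨((α, p), b), mem_filter.2 ⟨mem_univ _, β, hb⟩, rfl⟩⟩
  · rintro ⟨⟨α, β⟩, p⟩ - ⟨⟨α', β'⟩, p'⟩ - h
    simp only [Prod.mk.injEq] at h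
    obtain ⟨hβ, rfl, rfl⟩ := h
    rw [sub_right_injective hβ]

variable {D e S} {ε : ℝ} {he : ∃ v, v ∉ Set.range e}

lemma DetAlgorithm.eq_of_mem_knownBits {X : F × F × F → Bool}
    (hD : ∀ c, IsCertificate (hardInstance e S X c he) (1 - ε) (D.run (hardInstance e S X c he)))
    {i : (F × F × F) × Bool} (hi : i ∈ D.knownBits e S (D.memory (halfLineStream e X))) :
    X i.1 = i.2 := by
  obtain ⟨-, β, hβ⟩ := mem_filter.1 hi
  rw [← D.run_hardInstance e S X (i.1.1, β) he] at hβ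
  exact (mem_halfLine.1 ((hD _).mem_halfLine_of_eq_some hβ)).2

variable [NoZeroDivisors F]

lemma DetAlgorithm.le_sum_card_im_of_card_knownBits_le {X : F × F × F → Bool}
    (hD : ∀ c, IsCertificate (hardInstance e S X c he) (1 - ε) (D.run (hardInstance e S X c he)))
    (hX : #(D.knownBits e S (D.memory (halfLineStream e X))) ≤ s) :
    (Fintype.card F : ℝ) ^ 2 * (Fintype.card F * #S - ε * n) - #S * s ≤
      ∑ c, (#S : ℝ) * #(im (D.run (hardInstance e S X c he))) := by
  have hrevealed : ∑ c, (#(revealed e S c (D.run (hardInstance e S X c he))) : ℝ) ≤ #S * s := by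
    simp_rw [run_hardInstance]
    exact_mod_cast (D.sum_card_revealed_le e S _).trans (Nat.mul_le_mul_left _ hX)
  have hsum := sum_le_sum fun c (_ : c ∈ univ) => (hD c).card_mul_card_le
  simp only [sum_add_distrib, sum_const, Finset.card_univ, Fintype.card_prod, nsmul_eq_mul,
    Nat.cast_mul] at hsum
  linarith

lemma DetAlgorithm.le_sum_card_im
    (hD : ∀ i : (F × F × F → Bool) × F × F, IsCertificate (hardInstance e S i.1 i.2 he) (1 - ε)
      (D.run (hardInstance e S i.1 i.2 he))) :
    (2 : ℝ) ^ Fintype.card (F × F × F) *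
        ((Fintype.card F : ℝ) ^ 2 * (Fintype.card F * #S - ε * n) - #S * s) ≤
      ∑ i : (F × F × F → Bool) × F × F,
        2 * (#S : ℝ) * #(im (D.run (hardInstance e S i.1 i.2 he))) := by
  set B := (Fintype.card F : ℝ) ^ 2 * (Fintype.card F * #S - ε * n) - #S * s
  obtain hB | hB := le_or_gt B 0
  · exact (mul_nonpos_of_nonneg_of_nonpos (by positivity) hB).trans (by positivity)
  set few : Finset (F × F × F → Bool) :=
    {X | #(D.knownBits e S (D.memory (halfLineStream e X))) ≤ s}
  have hhalf : (2 : ℝ) ^ Fintype.card (F × F × F) ≤ 2 * #few := by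
    exact_mod_cast two_pow_card_le_two_mul_card_filter (fun X => D.memory (halfLineStream e X))
      (D.knownBits e S) fun X i => D.eq_of_mem_knownBits fun c => hD (X, c)
  calc (2 : ℝ) ^ Fintype.card (F × F × F) * B ≤ 2 * #few * B := by gcongr
    _ = 2 * ∑ _X ∈ few, B := by rw [sum_const, nsmul_eq_mul, mul_assoc]
    _ ≤ 2 * ∑ X ∈ few, ∑ c, (#S : ℝ) * #(im (D.run (hardInstance e S X c he))) := by
      gcongr with X hX
      exact le_sum_card_im_of_card_knownBits_le (fun c => hD (X, c)) (mem_filter.1 hX).2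
    _ ≤ 2 * ∑ X, ∑ c, (#S : ℝ) * #(im (D.run (hardInstance e S X c he))) := by
      gcongr
      exact subset_univ few
    _ = _ := by simp only [Fintype.sum_prod_type, mul_sum, mul_assoc]

end LowerBound

section Ratio

variable {F : Type*} [Fintype F] [Ring F] [NoZeroDivisors F] {n s M : ℕ} {ε ρ : ℝ}
  {A : RandAlgorithm n s}

lemma RandAlgorithm.Guarantees.le_mul_ratio (hA : A.Guarantees M ε ρ) (hρ : 0 ≤ ρ)
    {e : F × F ↪ Fin n} (he : ∃ v, v ∉ Set.range e) (hM : 2 * Fintype.card F ^ 2 + 1 ≤ M)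
    (S : Finset F) :
    (Fintype.card F : ℝ) ^ 2 * (Fintype.card F * #S - ε * n) - #S * s ≤
      2 * #S * (Fintype.card F : ℝ) ^ 2 * (ρ * (2 * #S + 1)) := by
  classical
  have hm : ∀ i : (F × F × F → Bool) × F × F, (hardInstance e S i.1 i.2 he).m ≤ M := fun i => by
    refine le_of_eq_of_le ?_ hM
    simp only [hardInstance, Fintype.card_prod, Fintype.card_bool]
    ring
  have hYao := hA.le_mul_sum_opt hm (w := fun _ => 2 * (#S : ℝ)) (fun _ => by positivity)
    fun D hD => D.le_sum_card_im hD
  have hpow : (0 : ℝ) < 2 ^ Fintype.card (F × F × F) := by positivity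
  refine le_of_mul_le_mul_left (hYao.trans ?_) hpow
  calc ρ * ∑ i : (F × F × F → Bool) × F × F, 2 * (#S : ℝ) * (hardInstance e S i.1 i.2 he).opt
      ≤ ρ * ∑ _i : (F × F × F → Bool) × F × F, 2 * (#S : ℝ) * (2 * #S + 1) := by
        gcongr with i
        exact_mod_cast opt_hardInstance_le e S i.1 i.2 he
    _ = _ := by
        simp only [sum_const, Finset.card_univ, Fintype.card_prod, Fintype.card_fun,
          Fintype.card_bool, nsmul_eq_mul]
        push_cast
        ring

lemma exists_embedding_notMem_range {α β : Type*} [Fintype α] [Fintype β]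
    (h : Fintype.card α < Fintype.card β) : ∃ e : α ↪ β, ∃ b, b ∉ Set.range e := by
  obtain ⟨e⟩ := Function.Embedding.nonempty_of_card_le h.le
  refine ⟨e, ?_⟩
  by_contra! hsurj
  exact h.not_ge (Fintype.card_le_of_surjective e hsurj)

lemma RandAlgorithm.Guarantees.le_mul_of_card (hA : A.Guarantees M ε ρ) (hρ : 0 ≤ ρ)
    (hn : Fintype.card F ^ 2 < n) (hn' : n ≤ 4 * Fintype.card F ^ 2)
    (hM : 2 * Fintype.card F ^ 2 + 1 ≤ M) (hε : 1 ≤ 2 * ε * Fintype.card F) (hε' : ε ≤ 1 / 8)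
    (hs : (s : ℝ) ≤ Fintype.card F ^ 3 / 4) : 1 / 176 ≤ ρ * ε := by
  obtain ⟨e, he⟩ := exists_embedding_notMem_range (α := F × F) (β := Fin n)
    (by simpa [sq] using hn)
  set q := Fintype.card F
  have hq : (0 : ℝ) < q := Nat.cast_pos.2 (Nat.pos_of_ne_zero fun h => by norm_num [h] at hε)
  have hε0 : 0 < ε := by
    by_contra! h
    nlinarith
  -- A strip of at least `8 ε q` lines has twice as many points as the at most `ε n ≤ 4 ε q ^ 2`
  -- vertices that may stay outside the domain.
  obtain ⟨S, -, hS⟩ := exists_subset_card_eq (s := (univ : Finset F)) (n := ⌈8 * ε * q⌉₊)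
    (by rw [Nat.ceil_le, Finset.card_univ]; nlinarith)
  have hS_lower : 8 * ε * q ≤ #S := hS ▸ Nat.le_ceil _
  have hS_upper : (#S : ℝ) < 8 * ε * q + 1 := hS ▸ Nat.ceil_lt_add_one (by positivity)
  have hundefined : ε * n ≤ #S * q / 2 := by
    have : (n : ℝ) ≤ 4 * q ^ 2 := by exact_mod_cast hn'
    nlinarith
  have hratio : q / 8 ≤ ρ * (2 * #S + 1) := by
    have hfactor : (0 : ℝ) < 2 * #S * q ^ 2 := by
      have : (0 : ℝ) < #S := by linarith
      positivity
    refine le_of_mul_le_mul_left ?_ hfactor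
    calc (2 * #S * q ^ 2 * (q / 8) : ℝ)
        = q ^ 2 * (q * #S - #S * q / 2) - #S * (q ^ 3 / 4) := by ring
      _ ≤ q ^ 2 * (q * #S - ε * n) - #S * s := by gcongr
      _ ≤ _ := hA.le_mul_ratio hρ he hM S
  have hopt : ρ * (2 * #S + 1) ≤ ρ * (22 * ε * q) := by
    gcongr
    linarith
  refine le_of_mul_le_mul_right ?_ hq
  linarith

end Ratio

lemma exists_field_card_sq_lt_le {n : ℕ} (hn : 4 < n) :
    ∃ (F : Type) (_ : Field F) (_ : Fintype F),
      Fintype.card F ^ 2 < n ∧ n ≤ 4 * Fintype.card F ^ 2 := by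
  set j := Nat.log 4 (n - 1)
  have hj : j ≠ 0 := (Nat.log_pos (by norm_num) (by omega)).ne'
  have hlower : 4 ^ j ≤ n - 1 := Nat.pow_log_le_self 4 (by omega)
  have hupper : n - 1 < 4 ^ (j + 1) := Nat.lt_pow_succ_log_self (by norm_num) (n - 1)
  have hfinite : Fintype (GaloisField 2 j) := Fintype.ofFinite _
  refine ⟨GaloisField 2 j, inferInstance, hfinite, ?_⟩
  have hsq : (2 ^ j) ^ 2 = 4 ^ j := by rw [pow_right_comm]; norm_num
  rw [← Nat.card_eq_fintype_card, GaloisField.card 2 j hj, hsq]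
  omega

lemma RandAlgorithm.Guarantees.le_mul_of_one_le_mul_sqrt {n s M : ℕ} {ε ρ : ℝ}
    {A : RandAlgorithm n s} (hA : A.Guarantees M ε ρ) (hρ : 0 ≤ ρ) (hM : 2 * n ≤ M)
    (hε : 1 ≤ ε * √(n : ℝ)) (hε' : ε ≤ 1 / 8)
    (hs : (s : ℝ) ≤ 1 / 32 * (n : ℝ) ^ (3 / 2 : ℝ)) : 1 / 176 ≤ ρ * ε := by
  have hsqrt_ge : 8 ≤ √(n : ℝ) := by nlinarith [Real.sqrt_nonneg (n : ℝ)]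
  have hn : 4 < n := by
    have := (Real.le_sqrt' (by norm_num)).1 hsqrt_ge
    exact_mod_cast (by linarith : (4 : ℝ) < n)
  obtain ⟨F, _, _, hlower, hupper⟩ := exists_field_card_sq_lt_le hn
  have hsqrt_le : √(n : ℝ) ≤ 2 * Fintype.card F :=
    Real.sqrt_le_iff.2 ⟨by positivity, by exact_mod_cast hupper.trans_eq (by ring)⟩
  refine hA.le_mul_of_card hρ hlower hupper (by omega) ?_ hε' ?_
  · have hε0 : 0 < ε := pos_of_mul_pos_left (one_pos.trans_le hε) (Real.sqrt_nonneg _)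
    calc 1 ≤ ε * √(n : ℝ) := hε
      _ ≤ ε * (2 * Fintype.card F) := by gcongr
      _ = 2 * ε * Fintype.card F := by ring
  · calc (s : ℝ) ≤ 1 / 32 * √(n : ℝ) ^ 3 := by
          rwa [Real.rpow_div_two_eq_sqrt _ n.cast_nonneg, Real.rpow_ofNat] at hs
      _ ≤ 1 / 32 * (2 * Fintype.card F : ℝ) ^ 3 := by gcongr
      _ = Fintype.card F ^ 3 / 4 := by ring

lemma min_one_mul_div_le_div_max {a c ε x : ℝ} (hc : 0 ≤ c) (hε : 0 < ε) (hx : 0 ≤ x)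
    (h : a * x ≤ ε) : min 1 a * c / ε ≤ c / max ε x := by
  have hmax : min 1 a * max ε x ≤ ε := by
    obtain hmax_eq | hmax_eq := max_choice ε x <;> rw [hmax_eq]
    · exact mul_le_of_le_one_left hε.le (min_le_left 1 a)
    · exact (mul_le_mul_of_nonneg_right (min_le_right 1 a) hx).trans h
  rw [div_le_div_iff₀ hε (lt_max_of_lt_left hε), mul_right_comm, mul_comm c]
  exact mul_le_mul_of_nonneg_right hmax hc

end EdgeCover

theorem mainTheorem5_general {n s M : ℕ} (hn : 0 < n) (hM : 2 * n ≤ M) {ε ρ : ℝ} (hε : ε < 1)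
    (hs : (s : ℝ) ≤ 1 / 32 * (n : ℝ) ^ (3 / 2 : ℝ)) {A : EdgeCover.RandAlgorithm n s}
    (hA : A.Guarantees M ε ρ) : 1 / 176 / max ε (1 / √(n : ℝ)) ≤ ρ := by
  have hsqrt : 0 < √(n : ℝ) := Real.sqrt_pos.2 (Nat.cast_pos.2 hn)
  have hρ : 1 ≤ ρ := hA.one_le hn (by omega) hε
  set η := max ε (1 / √(n : ℝ))
  have hη : 1 / √(n : ℝ) ≤ η := le_max_right _ _
  rw [div_le_iff₀ ((one_div_pos.2 hsqrt).trans_le hη)]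
  obtain hη_large | hη_small := le_or_gt (1 / 8) η
  · nlinarith
  · exact (hA.mono (le_max_left _ _)).le_mul_of_one_le_mul_sqrt (zero_le_one.trans hρ) hM
      ((div_le_iff₀ hsqrt).1 hη) hη_small.le hs

/-- Lower bound for certified streaming edge cover. Here `κ` is the constant hidden in the memory
bound `o(n ^ (3/2))`, `a` the one in `ε = Ω(1/√n)`, and `C a`, which depends on `a` only, the one
in `ρ = Ω(1/ε)`. -/
theorem mainTheorem5 :
    ∃ κ : ℝ, 0 < κ ∧ ∃ C : ℝ → ℝ, (∀ a : ℝ, 0 < a → 0 < C a) ∧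
      ∀ n₀ : ℕ, ∃ n : ℕ, n₀ ≤ n ∧
        ∀ a : ℝ, 0 < a → ∀ ε : ℝ, a / √(n : ℝ) ≤ ε → ε < 1 →
          ∀ (s : ℕ) (ρ : ℝ), (s : ℝ) ≤ κ * (n : ℝ) ^ (3 / 2 : ℝ) →
            (∃ A : EdgeCover.RandAlgorithm n s, A.Guarantees (n ^ 2) ε ρ) → C a / ε ≤ ρ := by
  refine ⟨1 / 32, by norm_num, fun a => min 1 a * (1 / 176), fun a ha => by positivity,
    fun n₀ => ⟨n₀ + 2, by omega, ?_⟩⟩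
  rintro a ha ε hε hε1 s ρ hs ⟨A, hA⟩
  have hε0 : 0 < ε := lt_of_lt_of_le (by positivity) hε
  exact (EdgeCover.min_one_mul_div_le_div_max (by norm_num) hε0 (by positivity)
    (by rwa [mul_one_div])).trans (mainTheorem5_general (by omega) (by nlinarith) hε1 hs hA)
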